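/- Let $q$ be a prime power, $\mathbb{F}_q$ the field with $q$ elements, $\chi$ a nontrivial additive character of $\mathbb{F}_q$, and for $x\in\mathbb{F}_q^n$ write $\|x\|=x_1^2+\dots+x_n^2\in\mathbb{F}_q$ and $S_r=\{x\in\mathbb{F}_q^n:\|x\|=r\}$. For $C\in\mathbb{R}$ we say that the sphere extension estimate holds in $\mathbb{F}_q^n$ with constant $C$ if for every $r\in\mathbb{F}_q\setminus\{0\}$ and every $f\colon S_r\to\mathbb{C}$, $$\Bigl(\sum_{c\in\mathbb{F}_q^n}\Bigl|\frac1{|S_r|}\sum_{x\in S_r}\chi(c\cdot x)f(x)\Bigr|^{\frac{2n+4}{n}}\Bigr)^{\frac{n}{2n+4}}\le C\Bigl(\frac1{|S_r|}\sum_{x\in S_r}|f(x)|^2\Bigr)^{1/2}.$$ (The sphere extension conjecture asserts this with $C$ independent of $q$.) Theorem. For every $C$ there is a constant $C'>0$, depending only on $C$, such that the following holds. Let $n\equiv 2\pmod 4$ be a natural number, $q\equiv 3\pmod 4$ a prime power, and assume that the sphere extension estimate holds in $\mathbb{F}_q^n$ with constant $C$. Then for every $X\subset\mathbb{F}_q^n$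 the number of isosceles triangles in $X$, i.e. of triples $(x,y,z)\in X^3$ with $\|x-y\|=\|x-z\|$ (sides with $\|\cdot\|=0$ and coinciding vertices allowed), is at most $$C'\Bigl(\frac{|X|^3}{q}+q^{n-1}|X|^{\frac{n+4}{n+2}}+q^{\frac{n-2}{2}}|X|^2\Bigr).$$ -/

import Mathlib

namespace FiniteFieldExtension

/-- The "norm" `‖x‖ = x₁² + ⋯ + xₙ²` of a vector over a field; it takes values in the field. -/
def qnorm {F : Type*} [Field F] {n : ℕ} (x : Fin n → F) : F := ∑ i, x i ^ 2

/-- The sphere `S_r = {x ∈ Fⁿ : x₁² + ⋯ + xₙ² = r}` centred at the origin. -/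
def sphere {F : Type*} [Field F] [Fintype F] [DecidableEq F] (n : ℕ) (r : F) :
    Finset (Fin n → F) :=
  Finset.univ.filter fun x => qnorm x = r

/-- The inverse Fourier transform of the measure `f dσ`, where `dσ` is the normalized surface
measure on `V`: `(f dσ)^∨(c) = |V|⁻¹ ∑_{x ∈ V} χ(c · x) f(x)`. Only the values of `f` on `V`
matter. -/
noncomputable def extension {F : Type*} [Field F] {n : ℕ} (χ : AddChar F ℂ)
    (V : Finset (Fin n → F)) (f : (Fin n → F) → ℂ) (c : Fin n → F) : ℂ :=
  (V.card : ℂ)⁻¹ * ∑ x ∈ V, χ (c ⬝ᵥ x) * f x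

/-- The `L^p` norm on `Fⁿ` with respect to the counting measure `dc`, for `0 < p < ∞`. -/
noncomputable def lpNormCounting {F : Type*} [Fintype F] {n : ℕ} (p : ℝ)
    (g : (Fin n → F) → ℂ) : ℝ :=
  (∑ c, ‖g c‖ ^ p) ^ (1 / p)

/-- The `L²` norm on `V` with respect to the normalized surface measure `dσ`. -/
noncomputable def l2NormSurface {F : Type*} {n : ℕ} (V : Finset (Fin n → F))
    (f : (Fin n → F) → ℂ) : ℝ :=
  Real.sqrt ((V.card : ℝ)⁻¹ * ∑ x ∈ V, ‖f x‖ ^ 2)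

/-- The `L² → L^p` extension estimate for `V` with constant `C`, that is `R*_V(2 → p) ≤ C`. -/
def ExtensionEstimate {F : Type*} [Field F] [Fintype F] {n : ℕ} (χ : AddChar F ℂ)
    (V : Finset (Fin n → F)) (p C : ℝ) : Prop :=
  ∀ f : (Fin n → F) → ℂ, lpNormCounting p (extension χ V f) ≤ C * l2NormSurface V f

/-- The isosceles triangles in `X`: the triples `(x, y, z) ∈ X³` with apex `x` such that
`‖x - y‖ = ‖x - z‖`. Sides of zero length and coinciding vertices are allowed. -/
def isoscelesTriangles {F : Type*} [Field F] [DecidableEq F] {n : ℕ} (X : Finset (Fin n → F)) :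
    Finset ((Fin n → F) × (Fin n → F) × (Fin n → F)) :=
  (X ×ˢ X ×ˢ X).filter fun t => qnorm (t.1 - t.2.1) = qnorm (t.1 - t.2.2)

end FiniteFieldExtension

namespace FiniteFieldExtension

open Finset ComplexConjugate

/-! Write `n = 2k` with `k` odd. Triangles with apex `x` are counted by the second moment of
`distCount X x`. Plancherel in the distance variable isolates the main term `|X|³/q`; what remains
involves the sums of `χ(s‖x - y‖)` over `y ∈ X`, with `s ≠ 0`. A Gaussian is, up to scaling, the
Fourier transform of a Gaussian, so a second Plancherel bounds this remainder by the frequency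
pieces `spherePart χ X x r` of the indicator of `X` (`card_isoscelesTriangles_le`).

For `r ≠ 0`, Hölder and the extension estimate control the mean square of a piece over `X`, and
Plancherel sums these bounds over `r` (`sum_ne_zero_norm_spherePart_sq_le`).

The extension hypothesis does not cover `r = 0`, but that piece is explicit in terms of `distCount X
x 0`. As `q ≡ 3 [MOD 4]` and `k` is odd, the `n`-th power of the Gauss sum is `-q ^ k`. This sign
bounds the quadratic form of the isotropic graph from above (`sum_isotropic_le`), which suffices for
a mean square bound because its matrix is nonnegative (`sum_sq_rowSum_le`). -/

/-! ### Abstract Plancherel and row sums of nonnegative matrices -/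

/-- Plancherel's identity for a kernel with orthogonal columns of square norm `Q`. -/
theorem plancherel_of_orthogonal {ι κ : Type*} [Fintype κ] [DecidableEq ι] (s : Finset ι)
    (K : κ → ι → ℂ) (Q : ℝ)
    (h : ∀ i j, ∑ t, K t i * conj (K t j) = if i = j then (Q : ℂ) else 0) (a : ι → ℂ) :
    ∑ t, ‖∑ i ∈ s, K t i * a i‖ ^ 2 = Q * ∑ i ∈ s, ‖a i‖ ^ 2 := by
  have key : ∑ t, (∑ i ∈ s, K t i * a i) * conj (∑ i ∈ s, K t i * a i)
      = (Q : ℂ) * ∑ i ∈ s, a i * conj (a i) := by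
    calc _ = ∑ t, ∑ i ∈ s, ∑ j ∈ s, (a i * conj (a j)) * (K t i * conj (K t j)) := by
          refine sum_congr rfl fun t _ => ?_
          rw [map_sum, sum_mul_sum]
          refine sum_congr rfl fun i _ => sum_congr rfl fun j _ => ?_
          rw [map_mul]; ring
      _ = ∑ i ∈ s, ∑ j ∈ s, (a i * conj (a j)) * ∑ t, K t i * conj (K t j) := by
          rw [sum_comm]
          refine sum_congr rfl fun i _ => ?_
          rw [sum_comm]
          exact sum_congr rfl fun j _ => (mul_sum _ _ _).symm
      _ = _ := by
          rw [mul_sum]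
          refine sum_congr rfl fun i hi => ?_
          simp [h, hi, mul_comm]
  simp only [Complex.mul_conj'] at key
  exact_mod_cast key

/-- A nonnegative matrix whose quadratic form is bounded by `l` has row sums that are bounded by
a multiple of `l` in mean square. -/
theorem sum_sq_rowSum_le {ι : Type*} (s : Finset ι) (M : ι → ι → ℝ) (hM : ∀ x y, 0 ≤ M x y)
    {l : ℝ} (hl : 0 < l)
    (h : ∀ f : ι → ℝ, ∑ x ∈ s, ∑ y ∈ s, M x y * (f x * f y) ≤ l * ∑ x ∈ s, f x ^ 2) :
    ∑ x ∈ s, (∑ y ∈ s, M x y) ^ 2 ≤ 16 * l ^ 2 * s.card := by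
  set v : ι → ℝ := fun x => ∑ y ∈ s, M x y with hv
  have hv0 : ∀ x, 0 ≤ v x := fun x => sum_nonneg fun y _ => hM x y
  -- This choice gives `16 * l ^ 2 * a ^ 2 = 1`, so half of the left side absorbs the quadratic term
  -- at the end.
  set a : ℝ := 1 / (4 * l) with ha
  have ha0 : 0 < a := by positivity
  -- Test the form on `1 + a * v`: by nonnegativity of `M`, one cross term already yields the mean
  -- square of the row sums.
  have h1 : a * ∑ x ∈ s, v x ^ 2 ≤ ∑ x ∈ s, ∑ y ∈ s, M x y * ((1 + a * v x) * (1 + a * v y)) := by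
    rw [mul_sum]
    refine sum_le_sum fun x _ => ?_
    calc a * v x ^ 2 = ∑ y ∈ s, M x y * (a * v x) := by rw [← sum_mul]; simp only [hv]; ring
      _ ≤ _ := by
        refine sum_le_sum fun y _ => mul_le_mul_of_nonneg_left ?_ (hM x y)
        have h3 := mul_nonneg ha0.le (hv0 x)
        have h4 := mul_nonneg ha0.le (hv0 y)
        nlinarith [mul_nonneg h3 h4]
  have h2 : ∑ x ∈ s, (1 + a * v x) ^ 2 ≤ 2 * (s.card + a ^ 2 * ∑ x ∈ s, v x ^ 2) := by
    rw [mul_sum, card_eq_sum_ones, Nat.cast_sum, ← sum_add_distrib, mul_sum]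
    refine sum_le_sum fun x _ => ?_
    push_cast
    nlinarith [sq_nonneg (1 - a * v x)]
  have h3 : a * ∑ x ∈ s, v x ^ 2 ≤ l * (2 * (s.card + a ^ 2 * ∑ x ∈ s, v x ^ 2)) :=
    h1.trans ((h _).trans (mul_le_mul_of_nonneg_left h2 hl.le))
  have h4 : a * l = 1 / 4 := by rw [ha]; field_simp
  generalize ∑ x ∈ s, v x ^ 2 = N at h3 ⊢
  have h5 : 8 * l * (a * N) ≤ 8 * l * (l * (2 * (s.card + a ^ 2 * N))) :=
    mul_le_mul_of_nonneg_left h3 (by positivity)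
  have h6 : 8 * l * (a * N) = 2 * N := by linear_combination (8 * N) * h4
  have h7 : 8 * l * (l * (2 * (s.card + a ^ 2 * N))) = 16 * l ^ 2 * s.card + N := by
    linear_combination (16 * N * (a * l + 1 / 4)) * h4
  linarith

/-! ### Additive characters and orthogonality -/

theorem addChar_sum {ι F : Type*} [Field F] (ψ : AddChar F ℂ) (s : Finset ι) (f : ι → F) :
    ψ (∑ i ∈ s, f i) = ∏ i ∈ s, ψ (f i) := by
  classical
  induction s using Finset.induction_on with
  | empty => simp
  | insert a s ha ih => rw [sum_insert ha, prod_insert ha, AddChar.map_add_eq_mul, ih]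

variable {F : Type*} [Field F] [Fintype F] [DecidableEq F] {χ : AddChar F ℂ} {n : ℕ}

theorem sum_addChar_mul (hχ : χ ≠ 1) (b : F) :
    ∑ t, χ (t * b) = if b = 0 then (Fintype.card F : ℂ) else 0 := by
  rw [AddChar.sum_mulShift b (AddChar.IsPrimitive.of_ne_one hχ)]
  split_ifs <;> simp

theorem sum_ne_zero_addChar_mul (hχ : χ ≠ 1) (b : F) :
    ∑ t ∈ univ.filter (· ≠ 0), χ (t * b)
      = (if b = 0 then (Fintype.card F : ℂ) else 0) - 1 := by
  rw [← sum_addChar_mul hχ b, filter_ne', ← sum_erase_add univ _ (mem_univ (0 : F))]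
  simp

/-- Exponential sums of coordinatewise phases factor. -/
theorem sum_addChar_sum {F : Type*} [Field F] [Fintype F] {n : ℕ}
    (ψ : AddChar F ℂ) (g : Fin n → F → F) :
    ∑ m : Fin n → F, ψ (∑ i, g i (m i)) = ∏ i, ∑ u, ψ (g i u) := by
  simp only [addChar_sum]
  rw [Finset.prod_univ_sum]
  simp

theorem sum_addChar_dotProduct (hχ : χ ≠ 1) (z : Fin n → F) :
    ∑ m : Fin n → F, χ (m ⬝ᵥ z) = if z = 0 then (Fintype.card F : ℂ) ^ n else 0 := by
  have := sum_addChar_sum χ (fun i u => u * z i)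
  simp only [dotProduct, this, sum_addChar_mul hχ]
  split_ifs with hz
  · simp [hz]
  · obtain ⟨i, hi⟩ := Function.ne_iff.mp hz
    exact prod_eq_zero (mem_univ i) (if_neg hi)

theorem plancherel_field (hχ : χ ≠ 1) (a : F → ℂ) :
    ∑ t, ‖∑ r, χ (t * r) * a r‖ ^ 2 = (Fintype.card F : ℝ) * ∑ r, ‖a r‖ ^ 2 := by
  refine plancherel_of_orthogonal univ (fun t r => χ (t * r)) _ (fun r s => ?_) a
  simp only [← AddChar.map_neg_eq_conj, ← AddChar.map_add_eq_mul]
  simpa [mul_add, add_neg_eq_zero] using sum_addChar_mul hχ (r + -s)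

theorem plancherel_vector (hχ : χ ≠ 1) (X : Finset (Fin n → F)) (a : (Fin n → F) → ℂ) :
    ∑ m : Fin n → F, ‖∑ y ∈ X, χ (m ⬝ᵥ y) * a y‖ ^ 2
      = (Fintype.card F : ℝ) ^ n * ∑ y ∈ X, ‖a y‖ ^ 2 := by
  refine plancherel_of_orthogonal X (fun m y => χ (m ⬝ᵥ y)) _ (fun y z => ?_) a
  simp only [← AddChar.map_neg_eq_conj, ← AddChar.map_add_eq_mul]
  simpa [dotProduct_add, dotProduct_neg, add_neg_eq_zero]
    using sum_addChar_dotProduct hχ (y + -z)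

/-! ### Gauss sums and Fourier transforms of Gaussians and spheres -/

theorem ringChar_ne_two_of_card {F : Type*} [Field F] [Fintype F]
    (hF : Fintype.card F ≡ 3 [MOD 4]) : ringChar F ≠ 2 := by
  intro h
  have := FiniteField.even_card_iff_char_two.mp h
  unfold Nat.ModEq at hF
  omega

theorem two_ne_zero_of_card {F : Type*} [Field F] [Fintype F]
    (hF : Fintype.card F ≡ 3 [MOD 4]) : (2 : F) ≠ 0 :=
  Ring.two_ne_zero (ringChar_ne_two_of_card hF)

theorem four_ne_zero_of_card {F : Type*} [Field F] [Fintype F]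
    (hF : Fintype.card F ≡ 3 [MOD 4]) : (4 : F) ≠ 0 := by
  have : (4 : F) = 2 * 2 := by norm_num
  rw [this]
  exact mul_ne_zero (two_ne_zero_of_card hF) (two_ne_zero_of_card hF)

theorem quadraticChar_neg_one_of_card (hF : Fintype.card F ≡ 3 [MOD 4]) :
    quadraticChar F (-1) = -1 := by
  rw [quadraticChar_neg_one (ringChar_ne_two_of_card hF), ZMod.χ₄_nat_three_mod_four hF]

theorem sum_addChar_sq_eq_gaussSum (hF : Fintype.card F ≡ 3 [MOD 4]) (hχ : χ ≠ 1) :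
    ∑ u, χ (u ^ 2) = gaussSum ((quadraticChar F).ringHomComp (Int.castRingHom ℂ)) χ := by
  have h1 : ∑ u : F, χ (u ^ 2) = ∑ v, ((quadraticChar F v : ℂ) + 1) * χ v := by
    rw [← sum_fiberwise univ (fun u : F => u ^ 2)]
    refine sum_congr rfl fun v _ => ?_
    rw [sum_congr rfl (g := fun _ => χ v) (fun u hu => by rw [(mem_filter.mp hu).2]),
      sum_const, nsmul_eq_mul]
    congr 1
    have := quadraticChar_card_sqrts (ringChar_ne_two_of_card hF) v
    rw [Set.toFinset_ofPred] at this
    exact_mod_cast this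
  have h2 : ∑ v, χ v = 0 := by simpa using sum_addChar_mul hχ 1
  simp only [h1, add_mul, one_mul, sum_add_distrib, h2, add_zero]
  rfl

/-- When `-1` is not a square, the square of the quadratic Gauss sum is `-q`. -/
theorem sq_sum_addChar_sq (hF : Fintype.card F ≡ 3 [MOD 4]) (hχ : χ ≠ 1) :
    (∑ u, χ (u ^ 2)) ^ 2 = -(Fintype.card F : ℂ) := by
  rw [sum_addChar_sq_eq_gaussSum hF hχ, gaussSum_sq _
    ((quadraticChar_isQuadratic F).comp _) (AddChar.IsPrimitive.of_ne_one hχ)]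
  · simp [MulChar.ringHomComp_apply, quadraticChar_neg_one_of_card hF]
  · rw [MulChar.ringHomComp_ne_one_iff Int.cast_injective]
    exact quadraticChar_ne_one (ringChar_ne_two_of_card hF)

/-- Completing the square: translate `u` by `b / (2 * s)`. -/
theorem sum_addChar_quadratic {F : Type*} [Field F] [Fintype F] {χ : AddChar F ℂ}
    (hF : Fintype.card F ≡ 3 [MOD 4]) {s : F} (hs : s ≠ 0) (b : F) :
    ∑ u, χ (s * u ^ 2 + u * b) = χ (-(b ^ 2) / (4 * s)) * ∑ u, χ (s * u ^ 2) := by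
  have h2 := two_ne_zero_of_card hF
  have h4 := four_ne_zero_of_card hF
  rw [← Equiv.sum_comp (Equiv.addRight (b / (2 * s))) (fun u => χ (s * u ^ 2)), mul_sum]
  refine sum_congr rfl fun u _ => ?_
  rw [← AddChar.map_add_eq_mul]
  congr 1
  simp only [Equiv.coe_addRight]
  field_simp
  ring

/-- The Fourier transform of a Gaussian on `Fⁿ` when `n ≡ 2` mod `4` and `|F| ≡ 3` mod `4`. -/
theorem sum_addChar_gaussian (hF : Fintype.card F ≡ 3 [MOD 4]) (hχ : χ ≠ 1) {k : ℕ} (hk : Odd k)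
    {s : F} (hs : s ≠ 0) (z : Fin (2 * k) → F) :
    ∑ m : Fin (2 * k) → F, χ (s * qnorm m + m ⬝ᵥ z)
      = -(Fintype.card F : ℂ) ^ k * χ (-qnorm z / (4 * s)) := by
  have h1 : ∀ m : Fin (2 * k) → F, s * qnorm m + m ⬝ᵥ z = ∑ i, (s * m i ^ 2 + m i * z i) :=
    fun m => by simp [qnorm, dotProduct, mul_sum, sum_add_distrib]
  have hs' : χ.mulShift s ≠ 1 := AddChar.IsPrimitive.of_ne_one hχ hs
  have h3 := sq_sum_addChar_sq hF hs'
  simp only [AddChar.mulShift_apply] at h3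
  simp only [h1]
  rw [sum_addChar_sum χ (fun i u => s * u ^ 2 + u * z i)]
  -- The `2k` Gauss sums multiply to `(-q) ^ k`, which is `-q ^ k` because `k` is odd.
  simp only [sum_addChar_quadratic hF hs, prod_mul_distrib, prod_const, card_univ,
    Fintype.card_fin, pow_mul, h3, hk.neg_pow]
  rw [← addChar_sum, mul_comm]
  congr 2
  simp [qnorm, sum_div, neg_div]

/-- The Fourier transform of the indicator of a sphere. -/
theorem card_mul_sum_sphere (hF : Fintype.card F ≡ 3 [MOD 4]) (hχ : χ ≠ 1) {k : ℕ} (hk : Odd k)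
    (r : F) (z : Fin (2 * k) → F) :
    (Fintype.card F : ℂ) * ∑ m ∈ sphere (2 * k) r, χ (m ⬝ᵥ z)
      = (if z = 0 then (Fintype.card F : ℂ) ^ (2 * k) else 0)
        - (Fintype.card F : ℂ) ^ k *
          ∑ s ∈ univ.filter (· ≠ 0), χ (-(s * r)) * χ (-qnorm z / (4 * s)) := by
  -- The condition `qnorm m = r` is detected by summing `χ (s * (qnorm m - r))` over `s`; the term
  -- `s = 0` later gives the delta at `z = 0`.
  have h1 : (Fintype.card F : ℂ) * ∑ m ∈ sphere (2 * k) r, χ (m ⬝ᵥ z)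
      = ∑ s : F, χ (-(s * r)) * ∑ m : Fin (2 * k) → F, χ (s * qnorm m + m ⬝ᵥ z) := by
    simp only [mul_sum]
    rw [sum_comm, sphere, sum_filter]
    refine sum_congr rfl fun m _ => ?_
    have := sum_addChar_mul hχ (qnorm m - r)
    simp only [sub_eq_zero] at this
    calc (if qnorm m = r then (Fintype.card F : ℂ) * χ (m ⬝ᵥ z) else 0)
        = (∑ t, χ (t * (qnorm m - r))) * χ (m ⬝ᵥ z) := by rw [this]; split_ifs <;> simp
      _ = _ := by
        rw [sum_mul]
        refine sum_congr rfl fun s _ => ?_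
        rw [← AddChar.map_add_eq_mul, ← AddChar.map_add_eq_mul]
        congr 1; ring
  rw [h1, ← sum_erase_add univ _ (mem_univ (0 : F)), ← filter_ne']
  simp only [zero_mul, neg_zero, AddChar.map_zero_eq_one, one_mul, zero_add,
    sum_addChar_dotProduct hχ]
  rw [sub_eq_neg_add, mul_sum, ← sum_neg_distrib]
  congr 1
  refine sum_congr rfl fun s hs => ?_
  rw [sum_addChar_gaussian hF hχ hk (mem_filter.mp hs).2]
  ring

/-- Sums over nonzero scalars are invariant under `s ↦ -1 / (4 s)`. -/
theorem sum_ne_zero_neg_inv_four_mul {M : Type*} [AddCommMonoid M]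
    (hF : Fintype.card F ≡ 3 [MOD 4]) (g : F → M) :
    ∑ s ∈ univ.filter (· ≠ 0), g (-1 / (4 * s)) = ∑ s ∈ univ.filter (· ≠ 0), g s := by
  have h4 := four_ne_zero_of_card hF
  refine sum_nbij' (fun s => -1 / (4 * s)) (fun s => -1 / (4 * s)) ?_ ?_ ?_ ?_ ?_
  · intro s hs; simp_all
  · intro s hs; simp_all
  · intro s hs
    have hs : s ≠ 0 := (mem_filter.mp hs).2
    field_simp
  · intro s hs
    have hs : s ≠ 0 := (mem_filter.mp hs).2
    field_simp
  · intro s _; rfl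

theorem card_mul_sum_sphere_zero (hF : Fintype.card F ≡ 3 [MOD 4]) (hχ : χ ≠ 1) {k : ℕ}
    (hk : Odd k) (z : Fin (2 * k) → F) :
    (Fintype.card F : ℂ) * ∑ m ∈ sphere (2 * k) (0 : F), χ (m ⬝ᵥ z)
      = (if z = 0 then (Fintype.card F : ℂ) ^ (2 * k) else 0)
        - (Fintype.card F : ℂ) ^ k * ((if qnorm z = 0 then (Fintype.card F : ℂ) else 0) - 1) := by
  rw [card_mul_sum_sphere hF hχ hk, ← sum_ne_zero_addChar_mul hχ,
    ← sum_ne_zero_neg_inv_four_mul hF]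
  congr 2
  refine sum_congr rfl fun s hs => ?_
  have hs : s ≠ 0 := (mem_filter.mp hs).2
  have h4 := four_ne_zero_of_card hF
  rw [mul_zero, neg_zero, AddChar.map_zero_eq_one, one_mul]
  congr 1
  field_simp

theorem card_sphere_le (hF : Fintype.card F ≡ 3 [MOD 4]) (hχ : χ ≠ 1) {k : ℕ} (hk : Odd k)
    {r : F} (hr : r ≠ 0) :
    ((sphere (2 * k) r).card : ℝ) ≤ 2 * (Fintype.card F : ℝ) ^ (2 * k - 1) := by
  have h := card_mul_sum_sphere hF hχ hk r 0
  have h1 := sum_ne_zero_addChar_mul hχ (-r)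
  have hq : (qnorm (0 : Fin (2 * k) → F)) = 0 := by simp [qnorm]
  simp only [mul_neg, neg_eq_zero, hr, if_false, zero_sub] at h1
  simp only [dotProduct_zero, AddChar.map_zero_eq_one, sum_const, nsmul_eq_mul, mul_one, if_true,
    hq, neg_zero, zero_div, h1, mul_neg, sub_neg_eq_add] at h
  have h' : (Fintype.card F : ℝ) * (sphere (2 * k) r).card
      = (Fintype.card F : ℝ) ^ (2 * k) + (Fintype.card F : ℝ) ^ k := by exact_mod_cast h
  have hq1 : (1 : ℝ) ≤ Fintype.card F := by exact_mod_cast Fintype.card_pos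
  have h2 : (Fintype.card F : ℝ) ^ k ≤ (Fintype.card F : ℝ) ^ (2 * k) :=
    pow_le_pow_right₀ hq1 (by omega)
  have h3 : (Fintype.card F : ℝ) ^ (2 * k)
      = Fintype.card F * (Fintype.card F : ℝ) ^ (2 * k - 1) := by
    have := hk.pos
    rw [← pow_succ']; congr 1; omega
  refine le_of_mul_le_mul_left ?_ (lt_of_lt_of_le one_pos hq1)
  linarith

/-! ### The isotropic distance graph -/

/-- The isotropic distance graph has no large eigenvalues apart from the principal one, because
the quadratic form `x₁² + ⋯ + xₙ²` is elliptic. -/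
theorem sum_isotropic_le (hF : Fintype.card F ≡ 3 [MOD 4]) (hχ : χ ≠ 1) {k : ℕ} (hk : Odd k)
    (X : Finset (Fin (2 * k) → F)) (f : (Fin (2 * k) → F) → ℝ) :
    ∑ x ∈ X, ∑ y ∈ X, (if qnorm (x - y) = 0 then (1 : ℝ) else 0) * (f x * f y)
      ≤ (∑ x ∈ X, f x) ^ 2 / Fintype.card F
        + (Fintype.card F : ℝ) ^ (k - 1) * ∑ x ∈ X, f x ^ 2 := by
  set q : ℝ := ((Fintype.card F : ℕ) : ℝ) with hq
  have hq0 : 0 < q := by rw [hq]; exact_mod_cast Fintype.card_pos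
  set P : ℝ := ∑ m ∈ sphere (2 * k) (0 : F), ‖∑ x ∈ X, χ (m ⬝ᵥ x) * (f x : ℂ)‖ ^ 2 with hP
  set Q : ℝ := ∑ x ∈ X, ∑ y ∈ X, (if qnorm (x - y) = 0 then (1 : ℝ) else 0) * (f x * f y) with hQ
  have hP0 : 0 ≤ P := sum_nonneg fun _ _ => sq_nonneg _
  have h1 : (P : ℂ) = ∑ x ∈ X, ∑ y ∈ X, ((f x : ℂ) * f y) *
      ∑ m ∈ sphere (2 * k) (0 : F), χ (m ⬝ᵥ (x - y)) := by
    rw [hP]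
    push_cast
    simp only [← Complex.mul_conj', mul_sum]
    rw [sum_congr rfl fun x _ => sum_comm, sum_comm]
    refine sum_congr rfl fun m _ => ?_
    rw [map_sum, sum_mul_sum]
    refine sum_congr rfl fun x _ => sum_congr rfl fun y _ => ?_
    rw [map_mul, Complex.conj_ofReal, ← AddChar.map_neg_eq_conj, dotProduct_sub, sub_eq_add_neg,
      AddChar.map_add_eq_mul]
    ring
  have h2 : (q : ℂ) * P = ∑ x ∈ X, ∑ y ∈ X, ((f x : ℂ) * f y) *
      ((if x = y then (q : ℂ) ^ (2 * k) else 0)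
        - (q : ℂ) ^ k * ((if qnorm (x - y) = 0 then (q : ℂ) else 0) - 1)) := by
    rw [h1, mul_sum]
    refine sum_congr rfl fun x _ => ?_
    rw [mul_sum]
    refine sum_congr rfl fun y _ => ?_
    have := card_mul_sum_sphere_zero hF hχ hk (x - y)
    simp only [sub_eq_zero] at this
    rw [mul_left_comm, hq, Complex.ofReal_natCast, this]
  have h3 : q * P = ∑ x ∈ X, ∑ y ∈ X, (f x * f y) *
      ((if x = y then q ^ (2 * k) else 0)
        - q ^ k * ((if qnorm (x - y) = 0 then q else 0) - 1)) := by
    have := h2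
    simp only [← Complex.ofReal_one, ← Complex.ofReal_zero, ← Complex.ofReal_pow,
      ← apply_ite Complex.ofReal] at this
    exact_mod_cast this
  have h4 : q * P = q ^ (2 * k) * ∑ x ∈ X, f x ^ 2 - q ^ k * (q * Q - (∑ x ∈ X, f x) ^ 2) := by
    rw [h3, hQ, sq (∑ x ∈ X, f x), sum_mul_sum]
    simp only [mul_sum, ← sum_sub_distrib]
    refine sum_congr rfl fun x hx => ?_
    simp only [mul_sub, sum_sub_distrib]
    congr 1
    · simp [hx]; ring
    · simp only [← sum_sub_distrib]
      refine sum_congr rfl fun y _ => ?_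
      split_ifs <;> ring
  have h5 : q ^ (2 * k) = q ^ k * (q * q ^ (k - 1)) := by
    have := hk.pos
    rw [← pow_succ', ← pow_add]
    congr 1
    omega
  -- `Q` enters `h4` with a negative sign, so `0 ≤ P` bounds it from above.
  have h6 : q * Q ≤ (∑ x ∈ X, f x) ^ 2 + q * (q ^ (k - 1) * ∑ x ∈ X, f x ^ 2) := by
    refine le_of_mul_le_mul_left ?_ (pow_pos hq0 k)
    rw [h5] at h4
    nlinarith [mul_nonneg hq0.le hP0]
  refine le_of_mul_le_mul_left ?_ hq0
  rw [mul_add, mul_div_cancel₀ _ hq0.ne']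
  exact h6

/-- The number of points of `X` at distance `t` from `x`. -/
def distCount (X : Finset (Fin n → F)) (x : Fin n → F) (t : F) : ℕ :=
  (X.filter fun y => qnorm (x - y) = t).card

theorem sum_sq_distCount_zero_le (hF : Fintype.card F ≡ 3 [MOD 4]) (hχ : χ ≠ 1) {k : ℕ}
    (hk : Odd k) (X : Finset (Fin (2 * k) → F)) :
    ∑ x ∈ X, (distCount X x 0 : ℝ) ^ 2
      ≤ 16 * ((Fintype.card F : ℝ) ^ (k - 1) + (X.card : ℝ) / Fintype.card F) ^ 2 * X.card := by
  have hq0 : (0 : ℝ) < Fintype.card F := by exact_mod_cast Fintype.card_pos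
  have := sum_sq_rowSum_le X (fun x y => if qnorm (x - y) = 0 then (1 : ℝ) else 0)
    (fun x y => by split_ifs <;> norm_num)
    (l := (Fintype.card F : ℝ) ^ (k - 1) + (X.card : ℝ) / Fintype.card F) (by positivity)
    (fun f => (sum_isotropic_le hF hχ hk X f).trans ?_)
  · simpa [distCount] using this
  · rw [add_mul, add_comm, div_mul_eq_mul_div]
    gcongr
    exact sq_sum_le_card_mul_sum_sq

theorem card_isoscelesTriangles (X : Finset (Fin n → F)) :
    (isoscelesTriangles X).card = ∑ x ∈ X, ∑ t, distCount X x t ^ 2 := by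
  rw [isoscelesTriangles, card_filter, sum_product]
  refine sum_congr rfl fun x _ => ?_
  rw [sum_product]
  simp only [distCount, card_filter, sq, sum_mul_sum]
  symm
  rw [sum_comm]
  refine sum_congr rfl fun y _ => ?_
  rw [sum_comm]
  refine sum_congr rfl fun z _ => ?_
  simp [eq_comm]

/-! ### From triangles to frequency spheres -/

/-- The Fourier transform of the indicator of `X`. -/
noncomputable def indicatorTransform (χ : AddChar F ℂ) (X : Finset (Fin n → F))
    (m : Fin n → F) : ℂ :=
  ∑ y ∈ X, χ (-(m ⬝ᵥ y))

/-- The part of the indicator of `X` with frequencies on the sphere of radius `r`, up to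
normalization. -/
noncomputable def spherePart (χ : AddChar F ℂ) (X : Finset (Fin n → F)) (x : Fin n → F)
    (r : F) : ℂ :=
  ∑ m ∈ sphere n r, χ (x ⬝ᵥ m) * indicatorTransform χ X m

theorem sum_norm_indicatorTransform_sq (hχ : χ ≠ 1) (X : Finset (Fin n → F)) :
    ∑ m, ‖indicatorTransform χ X m‖ ^ 2 = (Fintype.card F : ℝ) ^ n * X.card := by
  have h := plancherel_vector hχ X 1
  simp only [Pi.one_apply, mul_one, norm_one, one_pow, sum_const, nsmul_eq_mul] at h
  rw [← h]
  refine sum_congr rfl fun m _ => ?_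
  simp only [indicatorTransform, AddChar.map_neg_eq_conj]
  rw [← map_sum, RCLike.norm_conj]

theorem spherePart_eq_sum (X : Finset (Fin n → F)) (x : Fin n → F) (r : F) :
    spherePart χ X x r = ∑ y ∈ X, ∑ m ∈ sphere n r, χ (m ⬝ᵥ (x - y)) := by
  simp only [spherePart, indicatorTransform, mul_sum]
  rw [sum_comm]
  refine sum_congr rfl fun y _ => sum_congr rfl fun m _ => ?_
  rw [← AddChar.map_add_eq_mul, dotProduct_sub, dotProduct_comm x m, sub_eq_add_neg]

theorem sum_addChar_mul_spherePart (X : Finset (Fin n → F)) (x : Fin n → F) (t : F) :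
    ∑ r, χ (t * r) * spherePart χ X x r
      = ∑ y ∈ X, ∑ m : Fin n → F, χ (t * qnorm m + m ⬝ᵥ (x - y)) := by
  simp only [spherePart_eq_sum, mul_sum]
  rw [sum_comm]
  refine sum_congr rfl fun y _ => ?_
  rw [← sum_fiberwise univ (fun m : Fin n → F => qnorm m)]
  refine sum_congr rfl fun r _ => sum_congr rfl fun m hm => ?_
  rw [AddChar.map_add_eq_mul, (mem_filter.mp hm).2]

/-- Plancherel in the distance variable; the frequency `s = 0` contributes `|X|²`. -/
theorem card_mul_sum_sq_distCount (hχ : χ ≠ 1) (X : Finset (Fin n → F)) (x : Fin n → F) :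
    (Fintype.card F : ℝ) * ∑ t, (distCount X x t : ℝ) ^ 2
      = X.card ^ 2 + ∑ s ∈ univ.filter (· ≠ 0), ‖∑ y ∈ X, χ (s * qnorm (x - y))‖ ^ 2 := by
  have h := plancherel_field hχ (fun t => (distCount X x t : ℂ))
  simp only [Complex.norm_natCast] at h
  have h1 : ∀ s, ∑ r, χ (s * r) * (distCount X x r : ℂ) = ∑ y ∈ X, χ (s * qnorm (x - y)) := by
    intro s
    rw [← sum_fiberwise X (fun y => qnorm (x - y))]
    refine sum_congr rfl fun r _ => ?_
    rw [sum_congr rfl (g := fun _ => χ (s * r)) (fun y hy => by rw [(mem_filter.mp hy).2]),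
      sum_const, nsmul_eq_mul, mul_comm]
    rfl
  simp only [h1] at h
  rw [← h, filter_ne', ← add_sum_erase univ _ (mem_univ (0 : F))]
  simp

theorem sum_norm_sq_le_sum_spherePart (hF : Fintype.card F ≡ 3 [MOD 4]) (hχ : χ ≠ 1) {k : ℕ}
    (hk : Odd k) (X : Finset (Fin (2 * k) → F)) (x : Fin (2 * k) → F) :
    (Fintype.card F : ℝ) ^ (2 * k) *
        ∑ s ∈ univ.filter (· ≠ 0), ‖∑ y ∈ X, χ (s * qnorm (x - y))‖ ^ 2
      ≤ Fintype.card F * ∑ r, ‖spherePart χ X x r‖ ^ 2 := by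
  rw [← plancherel_field hχ, ← sum_ne_zero_neg_inv_four_mul hF, mul_sum]
  -- With `s = -1 / (4 * t)` the terms match for `t ≠ 0`; including `t = 0` as well makes Plancherel
  -- available.
  refine le_trans (sum_le_sum fun t ht => ?_)
    (sum_le_sum_of_subset_of_nonneg (filter_subset (· ≠ 0) _) fun _ _ _ => sq_nonneg _)
  have ht : t ≠ 0 := (mem_filter.mp ht).2
  have h4 := four_ne_zero_of_card hF
  rw [sum_addChar_mul_spherePart]
  simp only [sum_addChar_gaussian hF hχ hk ht]
  rw [← mul_sum, norm_mul, mul_pow, norm_neg, norm_pow, Complex.norm_natCast, ← pow_mul,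
    mul_comm k 2]
  refine le_of_eq ?_
  congr 4
  ext y
  congr 1
  field_simp

theorem card_isoscelesTriangles_le (hF : Fintype.card F ≡ 3 [MOD 4]) (hχ : χ ≠ 1) {k : ℕ}
    (hk : Odd k) (X : Finset (Fin (2 * k) → F)) :
    ((isoscelesTriangles X).card : ℝ) ≤ (X.card : ℝ) ^ 3 / Fintype.card F
      + (∑ x ∈ X, ∑ r, ‖spherePart χ X x r‖ ^ 2) / (Fintype.card F : ℝ) ^ (2 * k) := by
  set q : ℝ := ((Fintype.card F : ℕ) : ℝ) with hq
  have hq0 : 0 < q := by rw [hq]; exact_mod_cast Fintype.card_pos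
  rw [card_isoscelesTriangles, sum_div]
  have h3 : (X.card : ℝ) ^ 3 / q = ∑ x ∈ X, (X.card : ℝ) ^ 2 / q := by
    rw [sum_const, nsmul_eq_mul]; ring
  push_cast
  rw [h3, ← sum_add_distrib]
  refine sum_le_sum fun x _ => ?_
  have h1 := card_mul_sum_sq_distCount hχ X x
  have h2 := sum_norm_sq_le_sum_spherePart hF hχ hk X x
  rw [← hq] at h1 h2
  have hqk : 0 < q ^ (2 * k) := by positivity
  rw [div_add_div _ _ hq0.ne' hqk.ne', le_div_iff₀ (by positivity)]
  calc (∑ t, (distCount X x t : ℝ) ^ 2) * (q * q ^ (2 * k))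
      = (q * ∑ t, (distCount X x t : ℝ) ^ 2) * q ^ (2 * k) := by ring
    _ ≤ _ := by rw [h1]; linarith

/-- Membership `x ∈ X` matters: the term `y = x` supplies the delta contribution `q ^ (2 * k)`. -/
theorem spherePart_zero (hF : Fintype.card F ≡ 3 [MOD 4]) (hχ : χ ≠ 1) {k : ℕ} (hk : Odd k)
    {X : Finset (Fin (2 * k) → F)} {x : Fin (2 * k) → F} (hx : x ∈ X) :
    spherePart χ X x 0 = (Fintype.card F : ℂ) ^ k *
      (((Fintype.card F : ℂ) ^ (k - 1) + (X.card : ℂ) / Fintype.card F) - distCount X x 0) := by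
  have hq0 : (Fintype.card F : ℂ) ≠ 0 := by exact_mod_cast Fintype.card_ne_zero
  have h1 : (Fintype.card F : ℂ) * spherePart χ X x 0 = (Fintype.card F : ℂ) ^ (2 * k)
      - (Fintype.card F : ℂ) ^ k * (Fintype.card F * distCount X x 0 - X.card) := by
    rw [spherePart_eq_sum, mul_sum]
    simp only [card_mul_sum_sphere_zero hF hχ hk, sub_eq_zero]
    rw [sum_sub_distrib, ← mul_sum, sum_sub_distrib, sum_ite_eq, if_pos hx, ← sum_filter,
      sum_const, nsmul_eq_mul, sum_const, nsmul_eq_mul, mul_one, distCount,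
      mul_comm (Fintype.card F : ℂ) (card _ : ℂ)]
  have h5 : (Fintype.card F : ℂ) ^ (2 * k)
      = (Fintype.card F : ℂ) ^ k * (Fintype.card F * (Fintype.card F : ℂ) ^ (k - 1)) := by
    have := hk.pos
    rw [← pow_succ', ← pow_add]
    congr 1
    omega
  refine mul_left_cancel₀ hq0 ?_
  rw [h1, h5]
  field_simp
  ring

theorem sum_norm_spherePart_zero_sq_le (hF : Fintype.card F ≡ 3 [MOD 4]) (hχ : χ ≠ 1) {k : ℕ}
    (hk : Odd k) (X : Finset (Fin (2 * k) → F)) :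
    ∑ x ∈ X, ‖spherePart χ X x 0‖ ^ 2 ≤ (Fintype.card F : ℝ) ^ (2 * k) *
      (34 * ((Fintype.card F : ℝ) ^ (k - 1) + (X.card : ℝ) / Fintype.card F) ^ 2 * X.card) := by
  have hν := sum_sq_distCount_zero_le hF hχ hk X
  set l : ℝ := (Fintype.card F : ℝ) ^ (k - 1) + (X.card : ℝ) / Fintype.card F with hl
  calc ∑ x ∈ X, ‖spherePart χ X x 0‖ ^ 2
      ≤ ∑ x ∈ X, (Fintype.card F : ℝ) ^ (2 * k) * (2 * l ^ 2 + 2 * (distCount X x 0 : ℝ) ^ 2) := by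
        refine sum_le_sum fun x hx => ?_
        have h1 : spherePart χ X x 0
            = (((Fintype.card F : ℝ) ^ k * (l - distCount X x 0) : ℝ) : ℂ) := by
          rw [spherePart_zero hF hχ hk hx, hl]
          push_cast
          rfl
        rw [h1, Complex.norm_real, Real.norm_eq_abs, sq_abs, mul_pow, ← pow_mul, mul_comm k 2]
        gcongr
        nlinarith [sq_nonneg (l + distCount X x 0)]
    _ = (Fintype.card F : ℝ) ^ (2 * k) *
          (2 * l ^ 2 * X.card + 2 * ∑ x ∈ X, (distCount X x 0 : ℝ) ^ 2) := by
        rw [← mul_sum, sum_add_distrib, sum_const, nsmul_eq_mul, ← mul_sum]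
        ring
    _ ≤ _ := by
        -- Here `34 = 2 + 2 * 16`, with `16` from the row sum bound.
        gcongr
        linarith

/-! ### Nonzero radii: Hölder and the extension estimate -/

theorem sum_sq_le_card_rpow_mul_lpNormCounting_sq {F : Type*} [Fintype F] {n : ℕ}
    (X : Finset (Fin n → F)) {p : ℝ} (hp : 2 ≤ p)
    (g : (Fin n → F) → ℂ) :
    ∑ x ∈ X, ‖g x‖ ^ 2 ≤ (X.card : ℝ) ^ (1 - 2 / p) * lpNormCounting p g ^ 2 := by
  have hp0 : 0 < p := by linarith
  have h1 := Real.rpow_sum_le_const_mul_sum_rpow_of_nonneg X (f := fun x => ‖g x‖ ^ 2)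
    (p := p / 2) (by linarith) (fun _ _ => sq_nonneg _)
  have h2 : ∀ x, (‖g x‖ ^ 2) ^ (p / 2) = ‖g x‖ ^ p := fun x => by
    rw [← Real.rpow_natCast, ← Real.rpow_mul (norm_nonneg _)]
    congr 1
    push_cast
    ring
  simp only [h2] at h1
  have h3 : ∑ x ∈ X, ‖g x‖ ^ p ≤ ∑ x, ‖g x‖ ^ p :=
    sum_le_sum_of_subset_of_nonneg (subset_univ _) fun _ _ _ => by positivity
  have hS : 0 ≤ ∑ x, ‖g x‖ ^ p := sum_nonneg fun _ _ => by positivity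
  have hX : 0 ≤ ∑ x ∈ X, ‖g x‖ ^ 2 := sum_nonneg fun _ _ => by positivity
  have h4 := Real.rpow_le_rpow (by positivity)
    (h1.trans (mul_le_mul_of_nonneg_left h3 (by positivity))) (z := 2 / p) (by positivity)
  rw [← Real.rpow_mul hX, Real.mul_rpow (by positivity) hS, ← Real.rpow_mul (by positivity),
    show p / 2 * (2 / p) = 1 by field_simp, Real.rpow_one,
    show (p / 2 - 1) * (2 / p) = 1 - 2 / p by field_simp] at h4
  refine h4.trans_eq ?_
  rw [lpNormCounting, ← Real.rpow_natCast, ← Real.rpow_mul hS]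
  congr 2
  push_cast
  ring

theorem sum_norm_spherePart_sq_le {p C : ℝ} (hp : 2 ≤ p) {r : F}
    (h : ExtensionEstimate χ (sphere n r) p C) (X : Finset (Fin n → F)) :
    ∑ x ∈ X, ‖spherePart χ X x r‖ ^ 2 ≤ (sphere n r).card * C ^ 2 * (X.card : ℝ) ^ (1 - 2 / p) *
      ∑ m ∈ sphere n r, ‖indicatorTransform χ X m‖ ^ 2 := by
  set N : ℝ := (((sphere n r).card : ℕ) : ℝ) with hN
  set B : ℝ := ∑ m ∈ sphere n r, ‖indicatorTransform χ X m‖ ^ 2 with hB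
  rcases (sphere n r).eq_empty_or_nonempty with h0 | h0
  · have : ∀ x, spherePart χ X x r = 0 := fun x => by simp [spherePart, h0]
    simp [this, hB, h0]
  have hN0 : 0 < N := by rw [hN]; exact_mod_cast h0.card_pos
  have hB0 : 0 ≤ B := sum_nonneg fun _ _ => sq_nonneg _
  have h1 : ∀ x, spherePart χ X x r
      = N * extension χ (sphere n r) (indicatorTransform χ X) x := fun x => by
    rw [extension, hN, Complex.ofReal_natCast, ← mul_assoc, mul_inv_cancel₀, one_mul]
    · rfl
    · exact_mod_cast h0.card_pos.ne'
  have h2 : lpNormCounting p (extension χ (sphere n r) (indicatorTransform χ X)) ^ 2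
      ≤ C ^ 2 * (N⁻¹ * B) := by
    have h3 := pow_le_pow_left₀ (Real.rpow_nonneg (sum_nonneg fun _ _ => by positivity) _)
      (h (indicatorTransform χ X)) 2
    rwa [mul_pow, l2NormSurface, Real.sq_sqrt (by positivity)] at h3
  calc ∑ x ∈ X, ‖spherePart χ X x r‖ ^ 2
      = N ^ 2 * ∑ x ∈ X, ‖extension χ (sphere n r) (indicatorTransform χ X) x‖ ^ 2 := by
        rw [mul_sum]
        refine sum_congr rfl fun x _ => ?_
        rw [h1, norm_mul, mul_pow, Complex.norm_real, Real.norm_eq_abs, sq_abs]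
    _ ≤ N ^ 2 * ((X.card : ℝ) ^ (1 - 2 / p) * (C ^ 2 * (N⁻¹ * B))) := by
        gcongr
        exact (sum_sq_le_card_rpow_mul_lpNormCounting_sq X hp _).trans
          (mul_le_mul_of_nonneg_left h2 (by positivity))
    _ = _ := by field_simp

theorem sum_ne_zero_norm_spherePart_sq_le (hF : Fintype.card F ≡ 3 [MOD 4]) (hχ : χ ≠ 1) {k : ℕ}
    (hk : Odd k) {p C : ℝ} (hp : 2 ≤ p)
    (h : ∀ r : F, r ≠ 0 → ExtensionEstimate χ (sphere (2 * k) r) p C)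
    (X : Finset (Fin (2 * k) → F)) :
    ∑ r ∈ univ.filter (· ≠ 0), ∑ x ∈ X, ‖spherePart χ X x r‖ ^ 2
      ≤ (Fintype.card F : ℝ) ^ (2 * k) * (2 * C ^ 2 * (Fintype.card F : ℝ) ^ (2 * k - 1) *
        ((X.card : ℝ) ^ (1 - 2 / p) * X.card)) := by
  set D : ℝ := 2 * (Fintype.card F : ℝ) ^ (2 * k - 1) * C ^ 2 * (X.card : ℝ) ^ (1 - 2 / p) with hD
  have hD0 : 0 ≤ D := by positivity
  calc ∑ r ∈ univ.filter (· ≠ 0), ∑ x ∈ X, ‖spherePart χ X x r‖ ^ 2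
      ≤ ∑ r ∈ univ.filter (· ≠ 0), D * ∑ m ∈ sphere (2 * k) r, ‖indicatorTransform χ X m‖ ^ 2 := by
        refine sum_le_sum fun r hr => ?_
        have hr : r ≠ 0 := (mem_filter.mp hr).2
        refine (sum_norm_spherePart_sq_le hp (h r hr) X).trans ?_
        rw [hD]
        gcongr
        exact card_sphere_le hF hχ hk hr
    _ ≤ ∑ r, D * ∑ m ∈ sphere (2 * k) r, ‖indicatorTransform χ X m‖ ^ 2 :=
        sum_le_sum_of_subset_of_nonneg (filter_subset _ _) fun _ _ _ =>
          mul_nonneg hD0 (sum_nonneg fun _ _ => sq_nonneg _)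
    _ = D * ((Fintype.card F : ℝ) ^ (2 * k) * X.card) := by
        rw [← mul_sum, ← sum_norm_indicatorTransform_sq hχ X]
        congr 1
        -- The spheres of all radii partition the space.
        exact sum_fiberwise univ (fun m => qnorm m) _
    _ = _ := by rw [hD]; ring

end FiniteFieldExtension

open FiniteFieldExtension Finset

theorem theorem3p3 (C : ℝ) :
    ∃ C' : ℝ, 0 < C' ∧
      ∀ (n : ℕ), n ≡ 2 [MOD 4] →
      ∀ (F : Type*) [Field F] [Fintype F] [DecidableEq F], Fintype.card F ≡ 3 [MOD 4] →
      ∀ χ : AddChar F ℂ, χ ≠ 1 →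
        (∀ r : F, r ≠ 0 →
          FiniteFieldExtension.ExtensionEstimate χ (FiniteFieldExtension.sphere n r)
            ((2 * (n : ℝ) + 4) / n) C) →
        ∀ X : Finset (Fin n → F),
          ((FiniteFieldExtension.isoscelesTriangles X).card : ℝ) ≤
            C' * ((X.card : ℝ) ^ 3 / (Fintype.card F : ℝ)
              + (Fintype.card F : ℝ) ^ (n - 1) * (X.card : ℝ) ^ (((n : ℝ) + 4) / ((n : ℝ) + 2))
              + (Fintype.card F : ℝ) ^ ((n - 2) / 2) * (X.card : ℝ) ^ 2) := by
  -- Radius zero contributes `34 * 2 = 68`, from squaring a two-term sum, the main term `1`, and the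
  -- nonzero radii `2 * C ^ 2`.
  refine ⟨2 * C ^ 2 + 69, by positivity, ?_⟩
  intro n hn F _ _ _ hF χ hχ hE X
  obtain ⟨k, rfl⟩ : ∃ k, n = 2 * k := ⟨n / 2, by unfold Nat.ModEq at hn; omega⟩
  have hk : Odd k := by
    rw [Nat.odd_iff]; unfold Nat.ModEq at hn; omega
  have hk0 := hk.pos
  have hkR : (0 : ℝ) < k := by exact_mod_cast hk0
  set p : ℝ := (2 * ((2 * k : ℕ) : ℝ) + 4) / (2 * k : ℕ) with hp
  have hp2 : 2 ≤ p := by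
    rw [hp, le_div_iff₀ (by push_cast; positivity)]
    linarith
  set q : ℝ := ((Fintype.card F : ℕ) : ℝ) with hq
  have hq1 : 1 ≤ q := by rw [hq]; exact_mod_cast Fintype.card_pos
  have hq0 : 0 < q := by linarith
  set N : ℝ := ((X.card : ℕ) : ℝ) with hN
  have hN0 : 0 ≤ N := Nat.cast_nonneg _
  set e : ℝ := (((2 * k : ℕ) : ℝ) + 4) / (((2 * k : ℕ) : ℝ) + 2) with he
  have he1 : 1 ≤ e := by
    rw [he, le_div_iff₀ (by positivity)]
    linarith
  -- For this `p` one has `1 - 2 / p = 2 / (n + 2)`.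
  have hNe : N ^ (1 - 2 / p) * N = N ^ e := by
    have hexp : e = (1 - 2 / p) + 1 := by
      rw [he, hp]
      push_cast
      field_simp
      ring
    rcases hN0.eq_or_lt with h0 | h0
    · rw [← h0, mul_zero, Real.zero_rpow (by linarith)]
    · rw [hexp, Real.rpow_add_one h0.ne']
  have hNle : N ≤ N ^ e := by
    rcases Nat.eq_zero_or_pos X.card with h0 | h0
    · rw [hN, h0, Nat.cast_zero]
      exact Real.rpow_nonneg le_rfl _
    · exact Real.self_le_rpow_of_one_le (by rw [hN]; exact_mod_cast h0) he1
  have hT := card_isoscelesTriangles_le hF hχ hk X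
  have hz := sum_norm_spherePart_zero_sq_le hF hχ hk X
  have hnz := sum_ne_zero_norm_spherePart_sq_le hF hχ hk hp2 hE X
  rw [← hq, ← hN] at hT hz hnz
  rw [hNe] at hnz
  have hsplit : ∑ x ∈ X, ∑ r, ‖spherePart χ X x r‖ ^ 2
      = ∑ x ∈ X, ‖spherePart χ X x 0‖ ^ 2
        + ∑ r ∈ univ.filter (· ≠ 0), ∑ x ∈ X, ‖spherePart χ X x r‖ ^ 2 := by
    rw [sum_comm, filter_ne', add_sum_erase univ
      (fun r => ∑ x ∈ X, ‖spherePart χ X x r‖ ^ 2) (mem_univ (0 : F))]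
  have hT2 : ((isoscelesTriangles X).card : ℝ) ≤ N ^ 3 / q
      + (34 * (q ^ (k - 1) + N / q) ^ 2 * N + 2 * C ^ 2 * q ^ (2 * k - 1) * N ^ e) := by
    refine hT.trans (add_le_add_right ?_ _)
    rw [div_le_iff₀ (by positivity), hsplit, mul_comm _ (q ^ (2 * k)), mul_add]
    exact add_le_add hz hnz
  -- `h1` and `h2` absorb the radius-zero part into the first two terms of the bound; the third only
  -- adds slack.
  have h1 : (q ^ (k - 1)) ^ 2 * N ≤ q ^ (2 * k - 1) * N ^ e := by
    rw [← pow_mul]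
    gcongr
    omega
  have h2 : (N / q) ^ 2 * N ≤ N ^ 3 / q := by
    rw [div_pow, div_mul_eq_mul_div, ← pow_succ]
    gcongr
    nlinarith
  have h3 : (q ^ (k - 1) + N / q) ^ 2 * N ≤ 2 * ((q ^ (k - 1)) ^ 2 * N + (N / q) ^ 2 * N) := by
    rw [← add_mul, ← mul_assoc]
    gcongr
    nlinarith [sq_nonneg (q ^ (k - 1) - N / q)]
  have h4 : 0 ≤ N ^ 3 / q := by positivity
  have h5 : 0 ≤ q ^ (2 * k - 1) * N ^ e := by positivity
  have h6 : 0 ≤ q ^ ((2 * k - 2) / 2) * N ^ 2 := by positivity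
  nlinarith [mul_nonneg (sq_nonneg C) h4, mul_nonneg (sq_nonneg C) h6]
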